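/- Let $p$ be a prime. Let $S_{\mathrm{alg}}=\mathbf{Q}_p[h(-1),h(-2),\ldots]$ be the rank one Heisenberg vertex operator algebra over $\mathbf{Q}_p$ with vacuum $\mathbf{1}$ and conformal vector $\omega=\frac12h(-1)^2\mathbf{1}$; here $h(n)=n\,\partial/\partial h(-n)$ for $n>0$, $h(0)=0$, and the Virasoro modes are $L(n)=\frac12\sum_{j\in\mathbf{Z}}{:}h(j)h(n-j){:}$. For a finite multiset $I$ of negative integers put $h^I=\prod_{i\in I}h(i)$ and $|I|=-\sum_{i\in I}i$. For real $R\ge 1$ let $$S_R=\Big\{\sum_I a_Ih^I\in \mathbf{Q}_p[[h(-1),h(-2),\ldots]] \;:\; \lim_{|I|\to\infty}|a_I|R^{|I|}=0\Big\},$$ with the norm $|\sum_I a_Ih^I|_R=\sup_I|a_I|R^{|I|}$, and let $S=S_1$. The square bracket Virasoro modes $L[n]$ are defined by $$\sum_{n\in\mathbf{Z}}L[n]z^{-n-2}=e^{2z}\sum_{n\in\mathbf{Z}}L(n)(e^z-1)^{-n-2}-\tfrac1{24};$$ thus $L[-1]=L(0)+L(-1)$ and $L[0]=L(0)+\sum_{n\ge1}\frac{(-1)^{n+1}}{n(n+1)}L(n)$,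 and $L[n]u$ for $u\in S_R$ is understood as the sum of this series of operators applied to $u$, converging in the norm $|\cdot|_R$. Let $X=\varprojlim_m\mathbf{Z}/p^m(p-1)\mathbf{Z}\cong\mathbf{Z}_p\times\mathbf{Z}/(p-1)\mathbf{Z}$ be $p$-adic weight space, in which $\mathbf{Z}$ is embedded diagonally; a weight is odd if it does not lie in $2X$. A state $u\in S$ has $X$-weight $t\in X$ if there are states $u_i\in S_{\mathrm{alg}}$ and integers $k_i$ such that $L[0]u_i=k_iu_i$ for all $i$, $u_i\to u$ in $S$, and $k_i\to t$ in $X$. Let $r$ be a real number with $p^{1/p}\le r<p^{1/(p-1)}$. Then: (a) For every weight $t\in X$ there is a nonzero state $u\in S_r$ that has $X$-weight $t$. (b) For every $s\in\mathbf{Z}_p$ there is a nonzero state $u\in S_r$ such that $L[0]u=su$. Moreover, for every odd weight $t\in X$ there is a state $u\in S_r$ of $X$-weight $t-1$ such that $L[-1]u$ is a nonzero state of $S_r$ of $X$-weight $t$; and a state $u\in S$ satisfies $L[-1]u=0$ if and only if $u\in\mathbf{Q}_p\mathbf{1}$. -/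

import Mathlib

open Filter Topology
open scoped ENNReal

noncomputable section

namespace PadicHeisenberg

/-- `p`-adic weight space `X = lim ℤ/p^m(p-1)ℤ ≅ ℤ_p × ℤ/(p-1)ℤ`, with the product of
the `p`-adic and the discrete topology.  An integer `n` is embedded diagonally, as the cast
`(n : WeightSpace p)`. -/
abbrev WeightSpace (p : ℕ) [Fact p.Prime] : Type := ℤ_[p] × ZMod (p - 1)

/-- The algebraic Heisenberg algebra `S_alg = ℚ_p[h(-1), h(-2), …]`.  The variable of index `m : ℕ`
is `h(-(m+1))`, and the vacuum vector is the polynomial `1`. -/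
abbrev SAlg (p : ℕ) [Fact p.Prime] : Type := MvPolynomial ℕ ℚ_[p]

/-- Formal power series in `h(-1), h(-2), …`: all the spaces `S_R` are subspaces of this one. -/
abbrev Formal (p : ℕ) [Fact p.Prime] : Type := MvPowerSeries ℕ ℚ_[p]

/-- The degree `|I|` of a monomial `h^I`, where `h(-(m+1))` has degree `m+1`. -/
def wt (I : ℕ →₀ ℕ) : ℕ := I.sum fun m e => e * (m + 1)

/-- The norm `|∑ a_I h^I|_R = sup_I |a_I| R^|I|`, with value `∞` on formal series for which it is
not finite. -/
def normR {p : ℕ} [Fact p.Prime] (R : ℝ) (u : Formal p) : ℝ≥0∞ :=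
  ⨆ I : ℕ →₀ ℕ, ‖MvPowerSeries.coeff I u‖ₑ * ENNReal.ofReal (R ^ wt I)

/-- The space `S_R`: the series `∑ a_I h^I` with `|a_I| R^|I| → 0` as `|I| → ∞`, which is the
completion of `S_alg` for the norm `|·|_R`.  The `p`-adic Heisenberg algebra `S` is `S_1`. -/
def SR (p : ℕ) [Fact p.Prime] (R : ℝ) : Submodule ℚ_[p] (Formal p) where
  carrier := {u | Tendsto (fun I : ℕ →₀ ℕ => ‖MvPowerSeries.coeff I u‖ * R ^ wt I)
    (comap wt atTop) (𝓝 0)}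
  zero_mem' := by simpa using tendsto_const_nhds
  add_mem' := by
    intro u v hu hv
    have hu' := hu.abs
    have hv' := hv.abs
    have h := hu'.add hv'
    simp only [abs_zero, add_zero] at h
    refine squeeze_zero_norm (fun I => ?_) h
    rw [map_add, norm_mul, norm_norm, abs_mul, abs_mul, abs_norm, abs_norm, ← add_mul,
      Real.norm_eq_abs]
    exact mul_le_mul_of_nonneg_right (norm_add_le _ _) (abs_nonneg _)
  smul_mem' := by
    intro c u hu
    have h := hu.const_mul ‖c‖
    simpa [mul_assoc] using h

/-- The Heisenberg modes: `h(-(m+1))` is multiplication by the variable of index `m`,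
`h(0) = 0`, and `h(m+1) = (m+1) ∂/∂h(-(m+1))`, so that `[h(m), h(n)] = m δ_{m+n,0}`. -/
def heis {p : ℕ} [Fact p.Prime] : ℤ → Module.End ℚ_[p] (Formal p)
  | Int.ofNat 0 => 0
  | Int.ofNat (m + 1) => ((m + 1 : ℕ) : ℚ_[p]) • (MvPowerSeries.pderiv ℚ_[p] m).toLinearMap
  | Int.negSucc m => LinearMap.mulLeft ℚ_[p] (MvPowerSeries.X m)

/-- The normally ordered product `:h(i)h(j):`, with the smaller index on the left. -/
def normalOrder {p : ℕ} [Fact p.Prime] (i j : ℤ) : Module.End ℚ_[p] (Formal p) :=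
  if i ≤ j then heis i * heis j else heis j * heis i

/-- The sums over `j` in the definition of the Virasoro modes below are finite. -/
theorem normalOrder_coeff_finite {p : ℕ} [Fact p.Prime] (n : ℤ) (u : Formal p) (I : ℕ →₀ ℕ) :
    (Function.support fun j : ℤ =>
      MvPowerSeries.coeff I (normalOrder j (n - j) u)).Finite := by
  have key : ∀ (i : ℤ) (v : Formal p), MvPowerSeries.coeff I (heis i v) ≠ 0 →
      0 < i ∨ (i < 0 ∧ -((I.support.sup id : ℕ) : ℤ) - 1 ≤ i) := by
    intro i v hv
    match i with
    | Int.ofNat 0 => simp [heis] at hv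
    | Int.ofNat (m + 1) => left; simp only [Int.ofNat_eq_natCast]; omega
    | Int.negSucc m =>
      right
      have hm : m ∈ I.support := by
        by_contra hm
        apply hv
        simp only [heis, LinearMap.mulLeft_apply]
        rw [MvPowerSeries.X, MvPowerSeries.coeff_monomial_mul, if_neg]
        intro hle
        have := hle m
        simp only [Finsupp.single_eq_same, Finsupp.mem_support_iff, not_not] at this hm
        omega
      have : m ≤ I.support.sup id := Finset.le_sup (f := id) hm
      omega
  refine (Set.finite_Icc (-((I.support.sup id : ℕ) : ℤ) - 1)
    (n + ((I.support.sup id : ℕ) : ℤ) + 1)).subset ?_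
  intro j hj
  simp only [Function.mem_support, normalOrder] at hj
  simp only [Set.mem_Icc]
  split_ifs at hj with h
  · have := key j _ hj
    omega
  · have := key (n - j) _ hj
    omega

/-- The Virasoro mode `L(n) = ½ ∑_{j ∈ ℤ} :h(j)h(n-j):`, defined by
`Y(ω, z) = ∑ L(n) z^{-n-2}` for the conformal vector `ω = ½ h(-1)²𝟏`.  Each coefficient of
`L(n)u` is a finite sum. -/
def vir {p : ℕ} [Fact p.Prime] (n : ℤ) (u : Formal p) : Formal p := fun I =>
  (2 : ℚ_[p])⁻¹ * ∑ᶠ j : ℤ, MvPowerSeries.coeff I (normalOrder j (n - j) u)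

/-- The coefficient of `z^{-k-2}` in the Laurent series `e^{2z} (e^z - 1)^{-m-2}`. -/
def sqCoeff (p : ℕ) [Fact p.Prime] (k m : ℤ) : ℚ_[p] :=
  (((PowerSeries.exp ℚ_[p] : PowerSeries ℚ_[p]) : LaurentSeries ℚ_[p]) ^ 2 *
    (((PowerSeries.exp ℚ_[p] : PowerSeries ℚ_[p]) : LaurentSeries ℚ_[p]) - 1) ^ (-m - 2)).coeff
      (-k - 2)

/-- `w = L[k]u` in `S_R`.  The square bracket Virasoro modes are defined by
`∑ L[k] z^{-k-2} = Y[ω - (1/24)𝟏, z] = e^{2z} Y(ω, e^z - 1) - 1/24`, that is,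
`L[k] = ∑_m sqCoeff k m • L(m) - (1/24) δ_{k,-2}`.  The predicate says that this series, applied
to `u`, converges unconditionally to `w` for the norm `|·|_R`.  (For `u` in `S_alg` only finitely
many terms are nonzero, and `R` is immaterial.) -/
def IsSqVir {p : ℕ} [Fact p.Prime] (R : ℝ) (k : ℤ) (u w : Formal p) : Prop :=
  Tendsto
    (fun F : Finset ℤ => normR R
      ((∑ m ∈ F, sqCoeff p k m • vir m u) - (if k = -2 then (24 : ℚ_[p])⁻¹ • u else 0) - w))
    atTop (𝓝 0)

/-- `u` has `X`-weight `t`: it is the limit in `S = S_1` of a sequence of states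
`u_i` of `S_alg` with `L[0]u_i = k_i u_i`, where the integers `k_i` converge to `t` in weight
space. -/
def HasXWeight {p : ℕ} [Fact p.Prime] (u : Formal p) (t : WeightSpace p) : Prop :=
  ∃ (v : ℕ → SAlg p) (k : ℕ → ℤ),
    (∀ i, IsSqVir 1 0 (v i : Formal p) ((k i : ℚ_[p]) • (v i : Formal p))) ∧
    Tendsto (fun i => normR 1 ((v i : Formal p) - u)) atTop (𝓝 0) ∧
    Tendsto (fun i => (k i : WeightSpace p)) atTop (𝓝 t)

end PadicHeisenberg

end

/-! Everything happens on linear states `∑ a_m h(-(m+1))`. The states `(N-1)! h[-N]𝟏 = L[-1]^(N-1)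
h(-1)𝟏` have coefficients `m! S(N, m+1)`, with `S` the Stirling numbers of the second kind: the
Stirling recurrence (`stirlingCoeff_succ`) is the action of `L[-1] = L(-1) + L(0)` on linear states
(`vir_neg_one_add_vir_zero_lin`). As `[L[0], L[-1]] = L[-1]`, such a state has `L[0]`-eigenvalue `N`
(`sum_sqCoeff_mul_stirlingCoeff`).

The coefficients are integers divisible by `m!`, so `|a_m| ≤ |m!|` uniformly in `N`, and `|m!| r^m →
0` for `r < p^(1/(p-1))`. Choose positive integers `N_i → t` in weight space. By compactness of
`ℤ_p^ℕ`, after passing to a subsequence all coefficients converge. The limit lies in `S_r`, its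
coefficient of `h(-1)` is `1`, and the uniform bound turns coefficientwise convergence into
convergence in norm (`tendsto_normR_sub`). This gives (a). For (b), `L[0]` has coefficients
`±1/(n(n+1))`, unbounded but of polynomial growth; since `L(n)` lowers degree by `n`, the factor
`r^(-n)` with `r > 1` makes the tails uniformly small, so the eigenvalue equation passes to the
limit (`isSqVir_zero_lin_limit`).

Applying `L[-1]` replaces each `N_i` by `N_i + 1`, hence raises the weight of a limit state by one.
The kernel of `L[-1]` is computed by induction on degree, since `L(-1)` raises degree by one and
`L(0)` multiplies by it. -/

noncomputable section

namespace PadicHeisenberg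

/-! ### Residues of powers of `e^z - 1`. -/

section ExpSubOne

open PowerSeries

variable (K : Type*) [Field K]

/-- The power series `(e^z - 1) / z`. -/
def expQuot : PowerSeries K := PowerSeries.mk fun n => (((n + 1).factorial : K))⁻¹

theorem constantCoeff_expQuot : constantCoeff (expQuot K) = 1 := by
  rw [← coeff_zero_eq_constantCoeff_apply]
  simp [expQuot]

theorem expQuot_mul_inv : expQuot K * (expQuot K)⁻¹ = 1 :=
  PowerSeries.mul_inv_cancel _ (by simp [constantCoeff_expQuot])

theorem coeff_X_mul_derivative (f : PowerSeries K) (n : ℕ) :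
    coeff n (X * d⁄dX K f) = n * coeff n f := by
  rcases n with _ | n
  · simp
  · rw [coeff_succ_X_mul, coeff_derivative]; push_cast; ring

theorem coeff_natCast_mul (m n : ℕ) (f : PowerSeries K) :
    coeff n ((m : PowerSeries K) * f) = m * coeff n f := by
  rw [← map_natCast (C : K →+* PowerSeries K), coeff_C_mul]

variable [CharZero K]

theorem X_mul_expQuot : (X : PowerSeries K) * expQuot K = exp K - 1 := by
  ext n
  rcases n with _ | n
  · simp
  · simp [coeff_succ_X_mul, expQuot, coeff_exp, coeff_one]

theorem exp_eq_one_add : exp K = 1 + X * expQuot K := by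
  rw [X_mul_expQuot]; ring

theorem exp_eq_expQuot_add : exp K = expQuot K + X * d⁄dX K (expQuot K) := by
  have h := congrArg (d⁄dX K) (exp_eq_one_add K)
  rw [map_add, Derivation.leibniz, derivative_X, derivative_exp, derivative_one] at h
  simp only [smul_eq_mul] at h
  rw [h]; ring

/-- This is `d/dz (e^z - 1)^(-n) = -n e^z (e^z - 1)^(-n-1)`, cleared of its pole through `(expQuot
K)⁻¹ ^ n = z^n (e^z - 1)^(-n)`. All the residues below come from comparing coefficients in it. -/
theorem X_mul_derivative_inv_pow (n : ℕ) :
    (X : PowerSeries K) * d⁄dX K ((expQuot K)⁻¹ ^ n) =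
      (n : PowerSeries K) * ((expQuot K)⁻¹ ^ n - exp K * (expQuot K)⁻¹ ^ (n + 1)) := by
  rcases n with _ | n
  · simp
  · rw [derivative_pow, derivative_inv']
    have h1 := exp_eq_expQuot_add K
    have h2 := expQuot_mul_inv K
    set g := expQuot K
    set q := g⁻¹
    have h3 : X * d⁄dX K g = exp K - g := by rw [h1]; ring
    simp only [Nat.add_sub_cancel]
    linear_combination (-((n + 1 : ℕ) : PowerSeries K) * q ^ n * q ^ 2) * h3
      + ((n + 1 : ℕ) : PowerSeries K) * q ^ (n + 1) * h2

/-- The coefficient of `z^n` in `e^z (z / (e^z - 1))^(j+1)`, up to the factor `j`. -/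
theorem natCast_mul_coeff_exp_mul_inv_pow (n j : ℕ) :
    (j : K) * coeff n (exp K * (expQuot K)⁻¹ ^ (j + 1)) =
      (j - n) * coeff n ((expQuot K)⁻¹ ^ j) := by
  have h := congrArg (coeff n) (X_mul_derivative_inv_pow K j)
  rw [coeff_X_mul_derivative, coeff_natCast_mul, map_sub] at h
  linear_combination h

/-- The residue of `e^z (e^z - 1)^(-n-1)`. -/
theorem coeff_exp_mul_inv_pow_succ (n : ℕ) :
    coeff n (exp K * (expQuot K)⁻¹ ^ (n + 1)) = if n = 0 then 1 else 0 := by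
  split_ifs with hn
  · subst hn
    simp [constantCoeff_expQuot]
  · have h := natCast_mul_coeff_exp_mul_inv_pow K n n
    rw [sub_self, zero_mul] at h
    exact (mul_eq_zero.1 h).resolve_left (by exact_mod_cast hn)

theorem exp_mul_inv_pow_succ (n : ℕ) :
    exp K * (expQuot K)⁻¹ ^ (n + 1) = (expQuot K)⁻¹ ^ (n + 1) + X * (expQuot K)⁻¹ ^ n := by
  have h1 := exp_eq_one_add K
  have h2 := expQuot_mul_inv K
  linear_combination (expQuot K)⁻¹ ^ (n + 1) * h1 + X * (expQuot K)⁻¹ ^ n * h2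

/-- The residue of `(e^z - 1)^(-n-1)`. -/
theorem coeff_inv_pow_succ (n : ℕ) : coeff n ((expQuot K)⁻¹ ^ (n + 1)) = (-1) ^ n := by
  induction n with
  | zero => simp [constantCoeff_expQuot]
  | succ n ih =>
    have h := coeff_exp_mul_inv_pow_succ K (n + 1)
    rw [exp_mul_inv_pow_succ, map_add, coeff_succ_X_mul, ih, if_neg n.succ_ne_zero] at h
    rw [pow_succ (-1 : K)]
    linear_combination h

/-- The coefficient of `z^{-2}` in `e^{2z} (e^z - 1)^{-m-2}`. -/
theorem coeff_exp_sq_mul_inv_pow {m : ℕ} (hm : m ≠ 0) :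
    coeff m (exp K ^ 2 * (expQuot K)⁻¹ ^ (m + 2)) =
      (-1 : K) ^ (m + 1) / (m * (m + 1)) := by
  obtain ⟨n, rfl⟩ := Nat.exists_eq_succ_of_ne_zero hm
  -- With `m = n + 1`, this expresses the wanted coefficient through those of `e^z (z/(e^z -
  -- 1))^(m+1)` in degrees `m` and `m - 1`. The first is a vanishing residue (`h0`); the second
  -- comes from the residue `(-1)^n` (`h1`).
  have h := congrArg (fun f => coeff (n + 1) (exp K * f)) (X_mul_derivative_inv_pow K (n + 2))
  have hd : exp K * (X * d⁄dX K ((expQuot K)⁻¹ ^ (n + 2))) =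
      X * d⁄dX K (exp K * (expQuot K)⁻¹ ^ (n + 2)) - X * (exp K * (expQuot K)⁻¹ ^ (n + 2)) := by
    rw [Derivation.leibniz, derivative_exp]
    simp only [smul_eq_mul]
    ring
  have he : exp K * (((n + 2 : ℕ) : PowerSeries K) *
      ((expQuot K)⁻¹ ^ (n + 2) - exp K * (expQuot K)⁻¹ ^ (n + 2 + 1))) =
      ((n + 2 : ℕ) : PowerSeries K) * (exp K * (expQuot K)⁻¹ ^ (n + 2) -
        exp K ^ 2 * (expQuot K)⁻¹ ^ (n + 1 + 2)) := by ring
  have h0 := coeff_exp_mul_inv_pow_succ K (n + 1)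
  have h1 := natCast_mul_coeff_exp_mul_inv_pow K n (n + 1)
  rw [coeff_inv_pow_succ] at h1
  simp only [hd, he] at h
  rw [map_sub, coeff_X_mul_derivative, coeff_succ_X_mul, coeff_natCast_mul, map_sub, h0,
    if_neg n.succ_ne_zero] at h
  have hn1 : ((n : K) + 1) ≠ 0 := by exact_mod_cast n.succ_ne_zero
  have hn2 : ((n : K) + 1 + 1) ≠ 0 := by exact_mod_cast (n + 1).succ_ne_zero
  push_cast at h h1 ⊢
  rw [eq_div_iff (mul_ne_zero hn1 hn2)]
  simp only [Nat.succ_eq_add_one]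
  linear_combination ((n : K) + 1) * h + h1

/-- The residue of `e^{2z} (e^z - 1)^{-m-2}`. -/
theorem coeff_succ_exp_sq_mul_inv_pow (m : ℕ) :
    coeff (m + 1) (exp K ^ 2 * (expQuot K)⁻¹ ^ (m + 2)) = if m = 0 then 1 else 0 := by
  have h : exp K ^ 2 * (expQuot K)⁻¹ ^ (m + 2) = exp K * (expQuot K)⁻¹ ^ (m + 1 + 1) +
      X * (exp K * (expQuot K)⁻¹ ^ (m + 1)) := by
    have := exp_mul_inv_pow_succ K (m + 1)
    linear_combination exp K * this
  rw [h, map_add, coeff_succ_X_mul, coeff_exp_mul_inv_pow_succ, coeff_exp_mul_inv_pow_succ]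
  simp

end ExpSubOne

/-! ### Coefficients of `L[0]` and `L[-1]` in terms of the `L(m)`. -/

section SqCoeff

variable (p : ℕ) [Fact p.Prime]

theorem coe_exp_sub_one_eq :
    ((PowerSeries.exp ℚ_[p] : PowerSeries ℚ_[p]) : LaurentSeries ℚ_[p]) - 1 =
      HahnSeries.single 1 1 * ((expQuot ℚ_[p] : PowerSeries ℚ_[p]) : LaurentSeries ℚ_[p]) := by
  rw [← PowerSeries.coe_X, ← PowerSeries.coe_mul, X_mul_expQuot, PowerSeries.coe_sub,
    PowerSeries.coe_one]

theorem coe_exp_sub_one_zpow_neg (j : ℕ) :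
    (((PowerSeries.exp ℚ_[p] : PowerSeries ℚ_[p]) : LaurentSeries ℚ_[p]) - 1) ^ (-(j : ℤ)) =
      HahnSeries.single (-(j : ℤ)) 1 *
        (((expQuot ℚ_[p])⁻¹ ^ j : PowerSeries ℚ_[p]) : LaurentSeries ℚ_[p]) := by
  rw [zpow_neg, zpow_natCast]
  refine inv_eq_of_mul_eq_one_right ?_
  rw [coe_exp_sub_one_eq, mul_pow, PowerSeries.coe_pow, HahnSeries.single_pow, mul_mul_mul_comm,
    HahnSeries.single_mul_single, ← mul_pow, ← PowerSeries.coe_mul, expQuot_mul_inv,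
    PowerSeries.coe_one]
  simp

theorem sqCoeff_eq_coeff (k : ℤ) (j n : ℕ) (h : (n : ℤ) = j - k - 2) :
    sqCoeff p k (j - 2) =
      PowerSeries.coeff n (PowerSeries.exp ℚ_[p] ^ 2 * (expQuot ℚ_[p])⁻¹ ^ j) := by
  have h1 : -((j : ℤ) - 2) - 2 = -(j : ℤ) := by ring
  rw [sqCoeff, h1, coe_exp_sub_one_zpow_neg, mul_left_comm, ← PowerSeries.coe_pow,
    ← PowerSeries.coe_mul]
  have h2 : -k - 2 = n + -(j : ℤ) := by omega
  rw [h2, HahnSeries.coeff_single_mul_add, one_mul, PowerSeries.coeff_coe]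
  simp

/-- The series `e^{2z} (e^z - 1)^{-m-2}` has order `-m-2`, which exceeds `-k-2`. For `m < -2` it is
a genuine power series, and `-1 ≤ k` makes the exponent `-k-2` negative. -/
theorem sqCoeff_eq_zero {k m : ℤ} (hk : -1 ≤ k) (h : m < k) : sqCoeff p k m = 0 := by
  rcases le_or_gt (-2) m with hm | hm
  · obtain ⟨j, hj⟩ := Int.eq_ofNat_of_zero_le (show 0 ≤ m + 2 by omega)
    have h1 : -m - 2 = -(j : ℤ) := by omega
    rw [sqCoeff, h1, coe_exp_sub_one_zpow_neg, mul_left_comm, ← PowerSeries.coe_pow,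
      ← PowerSeries.coe_mul]
    have h2 : -k - 2 = (m - k) + -(j : ℤ) := by omega
    rw [h2, HahnSeries.coeff_single_mul_add, one_mul, PowerSeries.coeff_coe, if_pos (by omega)]
  · obtain ⟨j, hj⟩ := Int.eq_ofNat_of_zero_le (show 0 ≤ -m - 2 by omega)
    rw [sqCoeff, hj, zpow_natCast, ← PowerSeries.coe_one,
      ← PowerSeries.coe_sub, ← PowerSeries.coe_pow, ← PowerSeries.coe_pow, ← PowerSeries.coe_mul,
      PowerSeries.coeff_coe, if_pos (by omega)]

theorem sqCoeff_zero_zero : sqCoeff p 0 0 = 1 := by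
  have h := sqCoeff_eq_coeff p 0 2 0 (by norm_num)
  norm_num at h
  simpa [constantCoeff_expQuot] using h

theorem sqCoeff_zero_natCast {m : ℕ} (hm : m ≠ 0) :
    sqCoeff p 0 m = (-1 : ℚ_[p]) ^ (m + 1) / (m * (m + 1)) := by
  have h := sqCoeff_eq_coeff p 0 (m + 2) m (by push_cast; ring)
  rw [coeff_exp_sq_mul_inv_pow ℚ_[p] hm] at h
  rw [← h]
  congr 1
  push_cast
  ring

theorem sqCoeff_neg_one_neg_one : sqCoeff p (-1) (-1) = 1 := by
  have h := sqCoeff_eq_coeff p (-1) 1 0 (by norm_num)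
  norm_num at h
  simpa [constantCoeff_expQuot] using h

theorem sqCoeff_neg_one_natCast (m : ℕ) : sqCoeff p (-1) m = if m = 0 then 1 else 0 := by
  have h := sqCoeff_eq_coeff p (-1) (m + 2) (m + 1) (by push_cast; ring)
  rw [coeff_succ_exp_sq_mul_inv_pow] at h
  rw [← h]
  congr 1
  push_cast
  ring

end SqCoeff

/-! ### Heisenberg and Virasoro modes on coefficients of formal series. -/

section Modes

variable {p : ℕ} [Fact p.Prime]

theorem heis_zero : heis (p := p) 0 = 0 := rfl

theorem coeff_heis_succ (m : ℕ) (u : Formal p) (I : ℕ →₀ ℕ) :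
    MvPowerSeries.coeff I (heis ((m : ℤ) + 1) u) =
      (m + 1) * ((I m + 1) * MvPowerSeries.coeff (I + Finsupp.single m 1) u) := by
  have h : heis (p := p) ((m : ℤ) + 1) =
    ((m + 1 : ℕ) : ℚ_[p]) • (MvPowerSeries.pderiv ℚ_[p] m).toLinearMap := rfl
  rw [h, LinearMap.smul_apply, MvPowerSeries.coeff_smul,
    Derivation.coeFn_coe, MvPowerSeries.coeff_pderiv]
  push_cast
  ring

theorem heis_neg_succ (m : ℕ) (u : Formal p) :
    heis (-((m : ℤ) + 1)) u = MvPowerSeries.X m * u := by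
  have h : -((m : ℤ) + 1) = Int.negSucc m := by omega
  rw [h]
  rfl

theorem coeff_heis_neg_succ (m : ℕ) (u : Formal p) (I : ℕ →₀ ℕ) :
    MvPowerSeries.coeff I (heis (-((m : ℤ) + 1)) u) =
      if I m = 0 then 0 else MvPowerSeries.coeff (I - Finsupp.single m 1) u := by
  rw [heis_neg_succ, MvPowerSeries.X, MvPowerSeries.coeff_monomial_mul]
  have h : Finsupp.single m 1 ≤ I ↔ I m ≠ 0 := by
    rw [Finsupp.single_le_iff, Nat.one_le_iff_ne_zero]
  by_cases hm : I m = 0 <;> simp [h, hm]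

theorem normalOrder_comm (i j : ℤ) : normalOrder (p := p) i j = normalOrder j i := by
  unfold normalOrder
  rcases lt_trichotomy i j with h | h | h
  · rw [if_pos h.le, if_neg (not_le.2 h)]
  · rw [h]
  · rw [if_neg (not_le.2 h), if_pos h.le]

theorem normalOrder_zero_left (j : ℤ) : normalOrder (p := p) 0 j = 0 := by
  unfold normalOrder
  split_ifs <;> simp [heis_zero]

theorem coeff_normalOrder (l m : ℕ) (u : Formal p) (I : ℕ →₀ ℕ) :
    MvPowerSeries.coeff I (normalOrder (-((l : ℤ) + 1)) ((m : ℤ) + 1) u) =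
      if I l = 0 then 0 else (m + 1) * (((I - Finsupp.single l 1 : ℕ →₀ ℕ) m + 1) *
        MvPowerSeries.coeff (I - Finsupp.single l 1 + Finsupp.single m 1) u) := by
  rw [normalOrder, if_pos (by omega), Module.End.mul_apply, coeff_heis_neg_succ, coeff_heis_succ]

theorem coeff_vir (n : ℤ) (u : Formal p) (I : ℕ →₀ ℕ) :
    MvPowerSeries.coeff I (vir n u) =
      (2 : ℚ_[p])⁻¹ * ∑ᶠ j : ℤ, MvPowerSeries.coeff I (normalOrder j (n - j) u) := rfl

/-- `L(0)` is the degree operator. -/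
theorem coeff_vir_zero (u : Formal p) (I : ℕ →₀ ℕ) :
    MvPowerSeries.coeff I (vir 0 u) = wt I * MvPowerSeries.coeff I u := by
  have key : ∀ m : ℕ, MvPowerSeries.coeff I (normalOrder (-((m : ℤ) + 1)) ((m : ℤ) + 1) u) =
      (m + 1) * (I m * MvPowerSeries.coeff I u) := by
    intro m
    rw [coeff_normalOrder]
    split_ifs with h
    · simp [h]
    · have hle : Finsupp.single m 1 ≤ I := by
        rw [Finsupp.single_le_iff]; omega
      rw [tsub_add_cancel_of_le hle, Finsupp.tsub_apply, Finsupp.single_eq_same,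
        Nat.cast_sub (by omega)]
      push_cast
      ring
  set f : ℤ → ℚ_[p] := fun j => MvPowerSeries.coeff I (normalOrder j (0 - j) u) with hf
  have hneg : ∀ m : ℕ, f (-((m : ℤ) + 1)) = (m + 1) * (I m * MvPowerSeries.coeff I u) := by
    intro m
    rw [← key, hf]
    simp only [zero_sub, neg_neg]
  have hpos : ∀ m : ℕ, f ((m : ℤ) + 1) = (m + 1) * (I m * MvPowerSeries.coeff I u) := by
    intro m
    rw [← key, hf, normalOrder_comm (-((m : ℤ) + 1))]
    simp only [zero_sub]
  have hzero : f 0 = 0 := by simp [hf, normalOrder_zero_left]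
  have hsupp : Function.support f ⊆ ((I.support.image (fun m : ℕ => (m : ℤ) + 1) ∪
      I.support.image (fun m : ℕ => -((m : ℤ) + 1)) : Finset ℤ) : Set ℤ) := by
    intro j hj
    rw [Function.mem_support] at hj
    simp only [Finset.coe_union, Finset.coe_image, Set.mem_union, Set.mem_image,
      Finset.mem_coe, Finsupp.mem_support_iff]
    rcases lt_trichotomy j 0 with h | h | h
    · obtain ⟨m, rfl⟩ : ∃ m : ℕ, j = -((m : ℤ) + 1) := ⟨(-j - 1).toNat, by omega⟩
      refine Or.inr ⟨m, fun h0 => hj ?_, rfl⟩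
      rw [hneg, h0]; simp
    · exact absurd (h ▸ hzero) hj
    · obtain ⟨m, rfl⟩ : ∃ m : ℕ, j = (m : ℤ) + 1 := ⟨(j - 1).toNat, by omega⟩
      refine Or.inl ⟨m, fun h0 => hj ?_, rfl⟩
      rw [hpos, h0]; simp
  rw [coeff_vir, finsum_eq_sum_of_support_subset f hsupp, Finset.sum_union, Finset.sum_image,
    Finset.sum_image]
  · simp only [hneg, hpos]
    rw [wt, Finsupp.sum, Nat.cast_sum, Finset.sum_mul, ← two_mul, inv_mul_cancel_left₀ two_ne_zero]
    refine Finset.sum_congr rfl fun m _ => ?_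
    push_cast
    ring
  · intro a _ b _ h; simpa using h
  · intro a _ b _ h; simpa using h
  · rw [Finset.disjoint_left]
    intro j h1 h2
    simp only [Finset.mem_image] at h1 h2
    obtain ⟨a, -, ha⟩ := h1
    obtain ⟨b, -, hb⟩ := h2
    omega

theorem wt_add (I J : ℕ →₀ ℕ) : wt (I + J) = wt I + wt J :=
  Finsupp.sum_add_index' (fun _ => by simp) (fun _ _ _ => by ring)

theorem wt_single (m e : ℕ) : wt (Finsupp.single m e) = e * (m + 1) :=
  Finsupp.sum_single_index (by simp)

theorem wt_eq_zero_iff (I : ℕ →₀ ℕ) : wt I = 0 ↔ I = 0 := by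
  refine ⟨fun h => ?_, fun h => by simp [h, wt]⟩
  ext m
  rw [wt, Finsupp.sum, Finset.sum_eq_zero_iff] at h
  by_contra hm
  have := h m (Finsupp.mem_support_iff.2 hm)
  simp_all

/-- `L(-1)` raises the degree by one, and kills the vacuum vector. -/
theorem coeff_vir_neg_one_eq_zero (u : Formal p) (I : ℕ →₀ ℕ)
    (h : ∀ J : ℕ →₀ ℕ, J ≠ 0 → wt J + 1 = wt I → MvPowerSeries.coeff J u = 0) :
    MvPowerSeries.coeff I (vir (-1) u) = 0 := by
  have key : ∀ m : ℕ,
      MvPowerSeries.coeff I (normalOrder (-(((m + 1 : ℕ) : ℤ) + 1)) ((m : ℤ) + 1) u) = 0 := by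
    intro m
    rw [coeff_normalOrder]
    split_ifs with hm
    · rfl
    · rw [h, mul_zero, mul_zero]
      · intro h0
        have := DFunLike.congr_fun h0 m
        simp at this
      · have hle : Finsupp.single (m + 1) 1 ≤ I := by
          rw [Finsupp.single_le_iff]; omega
        have h1 := congrArg wt (tsub_add_cancel_of_le hle)
        rw [wt_add, wt_single] at h1
        rw [wt_add, wt_single]
        omega
  rw [coeff_vir, finsum_eq_zero_of_forall_eq_zero, mul_zero]
  intro j
  rcases lt_or_ge j (-1) with hj | hj
  · obtain ⟨m, rfl⟩ : ∃ m : ℕ, j = -(((m + 1 : ℕ) : ℤ) + 1) := ⟨(-j - 2).toNat, by omega⟩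
    rw [← key m]
    congr 3
    push_cast; ring
  · rcases eq_or_lt_of_le hj with rfl | hj
    · rw [normalOrder_comm]; simp [normalOrder_zero_left]
    · rcases eq_or_lt_of_le (show 0 ≤ j by omega) with rfl | hj
      · simp [normalOrder_zero_left]
      · obtain ⟨m, rfl⟩ : ∃ m : ℕ, j = (m : ℤ) + 1 := ⟨(j - 1).toNat, by omega⟩
        rw [normalOrder_comm, ← key m]
        congr 3
        push_cast; ring

end Modes

/-! ### Virasoro modes on linear states. -/

section Linear

variable {p : ℕ} [Fact p.Prime]

/-- The linear state `∑ a_m h(-(m+1))`. -/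
def lin (a : ℕ → ℚ_[p]) : Formal p := fun I =>
  ∑ m ∈ I.support, if I = Finsupp.single m 1 then a m else 0

theorem coeff_lin_single (a : ℕ → ℚ_[p]) (k : ℕ) :
    MvPowerSeries.coeff (Finsupp.single k 1) (lin a) = a k := by
  change ∑ m ∈ (Finsupp.single k 1).support,
    (if Finsupp.single k 1 = Finsupp.single m 1 then a m else 0) = a k
  rw [Finsupp.support_single k one_ne_zero]
  simp

theorem coeff_lin_of_ne (a : ℕ → ℚ_[p]) {I : ℕ →₀ ℕ} (h : ∀ k, I ≠ Finsupp.single k 1) :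
    MvPowerSeries.coeff I (lin a) = 0 :=
  Finset.sum_eq_zero fun m _ => if_neg (h m)

theorem eq_lin {u : Formal p} {a : ℕ → ℚ_[p]}
    (h1 : ∀ k, MvPowerSeries.coeff (Finsupp.single k 1) u = a k)
    (h2 : ∀ I, (∀ k, I ≠ Finsupp.single k 1) → MvPowerSeries.coeff I u = 0) : u = lin a := by
  ext I
  by_cases h : ∃ k, I = Finsupp.single k 1
  · obtain ⟨k, rfl⟩ := h
    rw [h1, coeff_lin_single]
  · push Not at h
    rw [h2 I h, coeff_lin_of_ne a h]

theorem lin_add (a b : ℕ → ℚ_[p]) : lin a + lin b = lin (a + b) :=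
  eq_lin (fun k => by simp [coeff_lin_single])
    (fun I h => by simp [coeff_lin_of_ne _ h])

theorem lin_sub (a b : ℕ → ℚ_[p]) : lin a - lin b = lin (a - b) :=
  eq_lin (fun k => by simp [coeff_lin_single])
    (fun I h => by simp [coeff_lin_of_ne _ h])

theorem lin_smul (c : ℚ_[p]) (a : ℕ → ℚ_[p]) : c • lin a = lin (c • a) :=
  eq_lin (fun k => by simp [coeff_lin_single])
    (fun I h => by simp [coeff_lin_of_ne _ h])

theorem lin_sum {ι : Type*} (F : Finset ι) (a : ι → ℕ → ℚ_[p]) :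
    ∑ i ∈ F, lin (a i) = lin (∑ i ∈ F, a i) :=
  eq_lin (fun k => by simp [coeff_lin_single])
    (fun I h => by simp [coeff_lin_of_ne _ h])

theorem lin_eq_coe_sum (a : ℕ → ℚ_[p]) (N : ℕ) (h : ∀ m, N ≤ m → a m = 0) :
    ((∑ m ∈ Finset.range N, MvPolynomial.monomial (Finsupp.single m 1) (a m) : SAlg p) :
      Formal p) = lin a := by
  classical
  refine eq_lin (fun k => ?_) (fun I hI => ?_)
  · rw [MvPolynomial.coeff_coe, MvPolynomial.coeff_sum]
    simp only [MvPolynomial.coeff_monomial, Finsupp.single_left_inj one_ne_zero]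
    rw [Finset.sum_ite_eq']
    split_ifs with hk
    · rfl
    · rw [h k (by simpa using hk)]
  · rw [MvPolynomial.coeff_coe, MvPolynomial.coeff_sum]
    refine Finset.sum_eq_zero fun m _ => ?_
    rw [MvPolynomial.coeff_monomial, if_neg (hI m).symm]

theorem coeff_normalOrder_lin (a : ℕ → ℚ_[p]) (l m : ℕ) (I : ℕ →₀ ℕ) :
    MvPowerSeries.coeff I (normalOrder (-((l : ℤ) + 1)) ((m : ℤ) + 1) (lin a)) =
      if I = Finsupp.single l 1 then (m + 1) * a m else 0 := by
  rw [coeff_normalOrder]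
  split_ifs with h1 h2 h2
  · subst h2; simp at h1
  · rfl
  · subst h2
    simp [coeff_lin_single]
  · rw [coeff_lin_of_ne, mul_zero, mul_zero]
    intro k hk
    apply h2
    have hle : Finsupp.single l 1 ≤ I := by
      rw [Finsupp.single_le_iff]; omega
    have h0 : I - Finsupp.single l 1 = 0 := by
      have h3 := congrArg Finsupp.degree hk
      rw [map_add, Finsupp.degree_single, Finsupp.degree_single] at h3
      exact (Finsupp.degree_eq_zero_iff _).1 (by omega)
    rw [← tsub_add_cancel_of_le hle, h0, zero_add]

theorem normalOrder_lin_of_nonneg (a : ℕ → ℚ_[p]) {i j : ℤ} (hi : 0 ≤ i) (hj : 0 ≤ j) :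
    normalOrder i j (lin a) = 0 := by
  have key : ∀ l m : ℕ, heis ((l : ℤ) + 1) (heis ((m : ℤ) + 1) (lin a)) = 0 := by
    intro l m
    ext I
    rw [coeff_heis_succ, coeff_heis_succ, coeff_lin_of_ne]
    · simp
    · intro k hk
      have h3 := congrArg Finsupp.degree hk
      simp only [map_add, Finsupp.degree_single] at h3
      omega
  rcases eq_or_lt_of_le hi with rfl | hi
  · simp [normalOrder_zero_left]
  rcases eq_or_lt_of_le hj with rfl | hj
  · rw [normalOrder_comm]; simp [normalOrder_zero_left]
  obtain ⟨l, rfl⟩ : ∃ m : ℕ, i = (m : ℤ) + 1 := ⟨(i - 1).toNat, by omega⟩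
  obtain ⟨m, rfl⟩ : ∃ m : ℕ, j = (m : ℤ) + 1 := ⟨(j - 1).toNat, by omega⟩
  unfold normalOrder
  split_ifs
  · exact key l m
  · exact key m l

/-- The modes `L(n)` with `n ≥ -1` act on linear states. -/
theorem vir_lin (a : ℕ → ℚ_[p]) {n : ℤ} (hn : -1 ≤ n) :
    vir n (lin a) = lin fun k => ((n + k + 1 : ℤ) : ℚ_[p]) * a (n + k).toNat := by
  have key : ∀ (l : ℕ) (I : ℕ →₀ ℕ),
      MvPowerSeries.coeff I (normalOrder (-((l : ℤ) + 1)) (n - -((l : ℤ) + 1)) (lin a)) =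
        if I = Finsupp.single l 1 then ((n + l + 1 : ℤ) : ℚ_[p]) * a (n + l).toNat else 0 := by
    intro l I
    -- When `n = -1` and `l = 0` the index `(n + l).toNat` is truncated, but its prefactor `n + l +
    -- 1` vanishes, in agreement with `h(0) = 0`.
    rcases eq_or_lt_of_le (show 0 ≤ n + l + 1 by omega) with h | h
    · have h' : n - -((l : ℤ) + 1) = 0 := by omega
      rw [h', normalOrder_comm, normalOrder_zero_left, ← h]
      simp
    · obtain ⟨m, hm⟩ : ∃ m : ℕ, n + l = m := ⟨(n + l).toNat, by omega⟩
      have h' : n - -((l : ℤ) + 1) = (m : ℤ) + 1 := by omega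
      rw [h', coeff_normalOrder_lin, hm]
      simp
  have key' : ∀ (l : ℕ) (I : ℕ →₀ ℕ),
      MvPowerSeries.coeff I (normalOrder (n + l + 1) (n - (n + l + 1)) (lin a)) =
        if I = Finsupp.single l 1 then ((n + l + 1 : ℤ) : ℚ_[p]) * a (n + l).toNat else 0 := by
    intro l I
    rw [← key, normalOrder_comm]
    congr 3 <;> ring
  have cases_j : ∀ j : ℤ, (∃ l : ℕ, j = -((l : ℤ) + 1)) ∨ (∃ l : ℕ, j = n + l + 1) ∨
      (0 ≤ j ∧ 0 ≤ n - j) := by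
    intro j
    rcases lt_or_ge j 0 with h | h
    · exact Or.inl ⟨(-j - 1).toNat, by omega⟩
    · rcases lt_or_ge n j with h' | h'
      · exact Or.inr (Or.inl ⟨(j - n - 1).toNat, by omega⟩)
      · exact Or.inr (Or.inr ⟨h, by omega⟩)
  refine eq_lin (fun k => ?_) (fun I hI => ?_)
  -- Only `j = -(k+1)` and its mirror image `n - j` contribute to the coefficient of `h(-(k+1))`.
  -- They contribute equally, which cancels the `½`.
  · have hne : -((k : ℤ) + 1) ≠ n + k + 1 := by omega
    rw [coeff_vir, finsum_eq_sum_of_support_subset (s := {-((k : ℤ) + 1), n + k + 1}),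
      Finset.sum_pair hne, key, key', if_pos rfl, ← two_mul, inv_mul_cancel_left₀ two_ne_zero]
    intro j hj
    rw [Function.mem_support] at hj
    simp only [Finset.coe_insert, Finset.coe_singleton, Set.mem_insert_iff, Set.mem_singleton_iff]
    rcases cases_j j with ⟨l, rfl⟩ | ⟨l, rfl⟩ | ⟨h1, h2⟩
    · rw [key] at hj
      have := (Finsupp.single_left_inj one_ne_zero).1 (of_not_not fun h => hj (if_neg h))
      subst this; exact Or.inl rfl
    · rw [key'] at hj
      have := (Finsupp.single_left_inj one_ne_zero).1 (of_not_not fun h => hj (if_neg h))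
      subst this; exact Or.inr rfl
    · rw [normalOrder_lin_of_nonneg a h1 h2] at hj
      simp at hj
  · rw [coeff_vir, finsum_eq_zero_of_forall_eq_zero, mul_zero]
    intro j
    rcases cases_j j with ⟨l, rfl⟩ | ⟨l, rfl⟩ | ⟨h1, h2⟩
    · rw [key, if_neg (hI l)]
    · rw [key', if_neg (hI l)]
    · rw [normalOrder_lin_of_nonneg a h1 h2, map_zero]

end Linear

/-! ### Stirling numbers and the `L[0]`-eigenvalue equation. -/

section Stirling

variable (p : ℕ) [Fact p.Prime]

/-- The coefficient of `h(-(m+1))` in the state `(N-1)! h[-N]𝟏`. -/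
def stirlingCoeff (N m : ℕ) : ℚ_[p] := ((m.factorial * N.stirlingSecond (m + 1) : ℕ) : ℚ_[p])

theorem stirlingCoeff_eq_zero {N m : ℕ} (h : N ≤ m) : stirlingCoeff p N m = 0 := by
  rw [stirlingCoeff, Nat.stirlingSecond_eq_zero_of_lt (Nat.lt_succ_of_le h)]
  simp

/-- This is `m!` times the recurrence `S(N+1, m+1) = (m+1) S(N, m+1) + S(N, m)`. At `m = 0` the last
term is `S(N, 0)`, which vanishes because `N ≠ 0`. -/
theorem stirlingCoeff_succ {N : ℕ} (hN : N ≠ 0) (m : ℕ) :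
    stirlingCoeff p (N + 1) m =
      (m + 1) * stirlingCoeff p N m + m * stirlingCoeff p N (m - 1) := by
  obtain ⟨N, rfl⟩ := Nat.exists_eq_succ_of_ne_zero hN
  rcases m with _ | m
  · simp [stirlingCoeff, Nat.stirlingSecond_succ_succ (N + 1) 0]
  · rw [stirlingCoeff, Nat.stirlingSecond_succ_succ, stirlingCoeff, stirlingCoeff,
      Nat.factorial_succ, Nat.add_sub_cancel]
    push_cast
    ring

theorem stirlingCoeff_zero {N : ℕ} (hN : N ≠ 0) : stirlingCoeff p N 0 = 1 := by
  induction N, Nat.one_le_iff_ne_zero.2 hN using Nat.le_induction with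
  | base => simp [stirlingCoeff, Nat.stirlingSecond_self 1]
  | succ N h ih =>
    rw [stirlingCoeff_succ p (by omega), ih (by omega)]
    simp

/-- Stirling numbers are integers. The point is that the bound does not depend on `N`. -/
theorem norm_stirlingCoeff_le (N m : ℕ) : ‖stirlingCoeff p N m‖ ≤ ‖(m.factorial : ℚ_[p])‖ := by
  rw [stirlingCoeff, Nat.cast_mul, norm_mul]
  exact mul_le_of_le_one_right (norm_nonneg _) (IsUltrametricDist.norm_natCast_le_one ℚ_[p] _)

/-- The commutation relation `[L[0], L[-1]] = L[-1]`, on the level of coefficients. -/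
theorem sqCoeff_zero_recurrence (n : ℕ) :
    (n : ℚ_[p]) * sqCoeff p 0 n + (n + 2) * sqCoeff p 0 (n + 1 : ℕ) = if n = 0 then 1 else 0 := by
  rw [sqCoeff_zero_natCast p n.succ_ne_zero]
  split_ifs with hn
  · subst hn; norm_num
  · rw [sqCoeff_zero_natCast p hn]
    have h0 : (n : ℚ_[p]) ≠ 0 := by exact_mod_cast hn
    have h1 : (n : ℚ_[p]) + 1 ≠ 0 := by exact_mod_cast n.succ_ne_zero
    have h2 : (n : ℚ_[p]) + 1 + 1 ≠ 0 := by exact_mod_cast (n + 1).succ_ne_zero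
    simp only [Nat.succ_eq_add_one]
    push_cast
    field_simp
    ring

/-- `(N-1)! h[-N]𝟏` is an eigenvector of `L[0]` with eigenvalue `N`. -/
theorem sum_sqCoeff_mul_stirlingCoeff {N : ℕ} (hN : N ≠ 0) (k T : ℕ) (hT : N ≤ T) :
    ∑ n ∈ Finset.range T, sqCoeff p 0 n * ((k + n + 1) * stirlingCoeff p N (k + n)) =
      N * stirlingCoeff p N k := by
  induction N, Nat.one_le_iff_ne_zero.2 hN using Nat.le_induction generalizing k T with
  | base =>
    rw [Finset.sum_eq_single 0]
    · rw [Nat.cast_zero, sqCoeff_zero_zero]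
      rcases k with _ | k
      · simp
      · rw [add_zero, stirlingCoeff_eq_zero p (by omega : 1 ≤ k + 1)]
        simp
    · intro n _ hn
      rw [stirlingCoeff_eq_zero p (by omega : 1 ≤ k + n)]
      simp
    · intro h
      exact absurd (Finset.mem_range.2 (by omega)) h
  | succ N h ih =>
    obtain ⟨T, rfl⟩ := Nat.exists_eq_succ_of_ne_zero (by omega : T ≠ 0)
    have hN0 : N ≠ 0 := by omega
    have hTN : N ≤ T := by omega
    -- The induction hypothesis at `k - 1`, with its `n = 0` term split off. The factor `k` makes
    -- the case `k = 0` trivial.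
    have key : (k : ℚ_[p]) * ∑ n ∈ Finset.range T,
        sqCoeff p 0 (n + 1 : ℕ) * ((k + n + 1) * stirlingCoeff p N (k + n)) +
          k * (k * stirlingCoeff p N (k - 1)) = k * (N * stirlingCoeff p N (k - 1)) := by
      rcases k with _ | k
      · simp
      · rw [← mul_add]
        congr 1
        rw [Nat.add_sub_cancel, ← ih hN0 k (T + 1) (by omega), Finset.sum_range_succ',
          Nat.cast_zero, sqCoeff_zero_zero]
        congr 1
        · refine Finset.sum_congr rfl fun n _ => ?_
          rw [show k + (n + 1) = k + 1 + n by ring]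
          push_cast
          ring
        · push_cast; simp
    have hS := ih hN0 k T hTN
    -- The commutator contribution: the recurrence leaves only `n = 0`, and this raises the
    -- eigenvalue from `N` to `N + 1`.
    have hδ : ∑ n ∈ Finset.range T, ((n : ℚ_[p]) * sqCoeff p 0 n +
        (n + 2) * sqCoeff p 0 (n + 1 : ℕ)) * ((k + n + 1) * stirlingCoeff p N (k + n)) =
          (k + 1) * stirlingCoeff p N k := by
      simp only [sqCoeff_zero_recurrence]
      rw [Finset.sum_eq_single 0]
      · simp
      · intro n _ hn
        simp [hn]
      · intro h
        exact absurd (Finset.mem_range.2 (by omega)) h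
    have hsplit : ∑ n ∈ Finset.range (T + 1),
        sqCoeff p 0 n * ((k + n + 1) * stirlingCoeff p (N + 1) (k + n)) =
          ∑ n ∈ Finset.range T, sqCoeff p 0 n * ((k + n + 1) ^ 2 * stirlingCoeff p N (k + n)) +
          (∑ n ∈ Finset.range T, sqCoeff p 0 (n + 1 : ℕ) *
            ((k + n + 2) * (k + n + 1) * stirlingCoeff p N (k + n)) +
            (k + 1) * k * stirlingCoeff p N (k - 1)) := by
      have e1 : ∀ n : ℕ, sqCoeff p 0 n * ((k + n + 1) * stirlingCoeff p (N + 1) (k + n)) =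
          sqCoeff p 0 n * ((k + n + 1) ^ 2 * stirlingCoeff p N (k + n)) +
          sqCoeff p 0 n * ((k + n + 1) * (k + n) * stirlingCoeff p N (k + n - 1)) := by
        intro n
        rw [stirlingCoeff_succ p hN0]
        push_cast
        ring
      simp only [e1]
      rw [Finset.sum_add_distrib]
      congr 1
      · rw [Finset.sum_range_succ, stirlingCoeff_eq_zero p (by omega : N ≤ k + T)]
        simp
      · rw [Finset.sum_range_succ', Nat.cast_zero, sqCoeff_zero_zero]
        congr 1
        · refine Finset.sum_congr rfl fun n _ => ?_
          rw [show k + (n + 1) - 1 = k + n by omega]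
          push_cast
          ring
        · simp
    -- Write `k + n + 1 = (k + 1) + n` in one factor of the square and `k + n + 2 = k + (n + 2)`;
    -- the leftover terms form the sum in `hδ`.
    have hcomb : ∑ n ∈ Finset.range T, sqCoeff p 0 n *
        ((k + n + 1) ^ 2 * stirlingCoeff p N (k + n)) +
        ∑ n ∈ Finset.range T, sqCoeff p 0 (n + 1 : ℕ) *
            ((k + n + 2) * (k + n + 1) * stirlingCoeff p N (k + n)) =
        (k + 1) * ∑ n ∈ Finset.range T,
          sqCoeff p 0 n * ((k + n + 1) * stirlingCoeff p N (k + n)) +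
        (k * ∑ n ∈ Finset.range T,
          sqCoeff p 0 (n + 1 : ℕ) * ((k + n + 1) * stirlingCoeff p N (k + n)) +
        ∑ n ∈ Finset.range T, ((n : ℚ_[p]) * sqCoeff p 0 n +
          (n + 2) * sqCoeff p 0 (n + 1 : ℕ)) * ((k + n + 1) * stirlingCoeff p N (k + n))) := by
      simp only [Finset.mul_sum, ← Finset.sum_add_distrib]
      refine Finset.sum_congr rfl fun n _ => ?_
      ring
    rw [hsplit, ← add_assoc, hcomb, hS, hδ, stirlingCoeff_succ p hN0]
    rw [Nat.cast_add_one]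
    linear_combination key

end Stirling

/-! ### Convergence of the square bracket modes and the kernel of `L[-1]`. -/

section SquareBracketModes

variable {p : ℕ} [Fact p.Prime]

theorem normR_zero (R : ℝ) : normR R (0 : Formal p) = 0 := by
  simp [normR]

theorem normR_eq_zero {R : ℝ} (hR : 0 < R) {u : Formal p} (h : normR R u = 0) : u = 0 := by
  ext I
  have h1 := (iSup_eq_bot.1 h) I
  rw [bot_eq_zero, mul_eq_zero] at h1
  rcases h1 with h1 | h1
  · simpa using h1
  · exact absurd (ENNReal.ofReal_eq_zero.1 h1) (not_le.2 (pow_pos hR _))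

theorem normR_lin_le {R ε : ℝ} {a : ℕ → ℚ_[p]} (h : ∀ k, ‖a k‖ * R ^ (k + 1) ≤ ε) :
    normR R (lin a) ≤ ENNReal.ofReal ε := by
  refine iSup_le fun I => ?_
  by_cases hI : ∃ k, I = Finsupp.single k 1
  · obtain ⟨k, rfl⟩ := hI
    rw [coeff_lin_single, wt_single, one_mul, ← ofReal_norm,
      ← ENNReal.ofReal_mul (norm_nonneg _)]
    exact ENNReal.ofReal_le_ofReal (h k)
  · push Not at hI
    rw [coeff_lin_of_ne a hI]
    simp

theorem lin_mem_SR {R : ℝ} {a : ℕ → ℚ_[p]}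
    (h : Tendsto (fun m => ‖a m‖ * R ^ (m + 1)) atTop (𝓝 0)) : lin a ∈ SR p R := by
  change Tendsto _ _ _
  rw [Metric.tendsto_nhds]
  intro ε hε
  have h1 := Metric.tendsto_nhds.1 h ε hε
  obtain ⟨M, hM⟩ := eventually_atTop.1 h1
  rw [eventually_comap]
  filter_upwards [eventually_ge_atTop (M + 1)] with w hw I hI
  by_cases hk : ∃ k, I = Finsupp.single k 1
  · obtain ⟨k, rfl⟩ := hk
    rw [wt_single, one_mul] at hI
    rw [coeff_lin_single, wt_single, one_mul]
    exact hM k (by omega)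
  · push Not at hk
    rw [coeff_lin_of_ne a hk]
    simpa using hε

theorem sum_neg_one_eq (u : Formal p) {F : Finset ℤ} (hF : ({-1, 0} : Finset ℤ) ⊆ F) :
    ∑ m ∈ F, sqCoeff p (-1) m • vir m u = vir (-1) u + vir 0 u := by
  rw [← Finset.sum_subset hF, Finset.sum_pair (by norm_num), sqCoeff_neg_one_neg_one]
  · have := sqCoeff_neg_one_natCast p 0
    rw [Nat.cast_zero, if_pos rfl] at this
    rw [this, one_smul, one_smul]
  · intro m _ hm
    simp only [Finset.mem_insert, Finset.mem_singleton, not_or] at hm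
    rcases lt_or_ge m (-1) with h | h
    · rw [sqCoeff_eq_zero p le_rfl h, zero_smul]
    · obtain ⟨n, rfl⟩ := Int.eq_ofNat_of_zero_le (show 0 ≤ m by omega)
      rw [sqCoeff_neg_one_natCast, if_neg (by simpa using hm.2), zero_smul]

/-- `L[-1] = L(-1) + L(0)`. -/
theorem isSqVir_neg_one_iff {R : ℝ} (hR : 0 < R) (u w : Formal p) :
    IsSqVir R (-1) u w ↔ vir (-1) u + vir 0 u = w := by
  have hev : (fun F : Finset ℤ => normR R ((∑ m ∈ F, sqCoeff p (-1) m • vir m u) -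
      (if (-1 : ℤ) = -2 then (24 : ℚ_[p])⁻¹ • u else 0) - w)) =ᶠ[atTop]
      fun _ => normR R (vir (-1) u + vir 0 u - w) := by
    filter_upwards [eventually_ge_atTop ({-1, 0} : Finset ℤ)] with F hF
    rw [sum_neg_one_eq u hF, if_neg (by norm_num), sub_zero]
  rw [IsSqVir, tendsto_congr' hev, tendsto_const_nhds_iff]
  refine ⟨fun h => sub_eq_zero.1 (normR_eq_zero hR h), fun h => ?_⟩
  rw [h, sub_self, normR_zero]

/-- In degree `d` the equation reads `d u_d = -L(-1) u_{d-1}`. As `L(-1)𝟏 = 0`, induction on `d`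
kills every component of positive degree. This holds already for formal series. -/
theorem isSqVir_neg_one_zero_iff {R : ℝ} (hR : 0 < R) (u : Formal p) :
    IsSqVir R (-1) u 0 ↔ ∃ c : ℚ_[p], u = c • (1 : Formal p) := by
  classical
  rw [isSqVir_neg_one_iff hR]
  constructor
  · intro h
    have hI : ∀ (d : ℕ) (I : ℕ →₀ ℕ), wt I = d → I ≠ 0 → MvPowerSeries.coeff I u = 0 := by
      intro d
      induction d with
      | zero => exact fun I h0 h1 => absurd ((wt_eq_zero_iff I).1 h0) h1
      | succ d ih =>
        intro I hd _
        have h1 := congrArg (MvPowerSeries.coeff I) h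
        rw [map_add, coeff_vir_zero, coeff_vir_neg_one_eq_zero u I
          (fun J hJ hw => ih J (by omega) hJ), zero_add, map_zero, hd] at h1
        exact (mul_eq_zero.1 h1).resolve_left (by exact_mod_cast d.succ_ne_zero)
    refine ⟨MvPowerSeries.coeff 0 u, ?_⟩
    ext I
    rw [MvPowerSeries.coeff_smul, MvPowerSeries.coeff_one]
    split_ifs with h0
    · rw [h0]; simp
    · rw [hI _ I rfl h0]; simp
  · rintro ⟨c, rfl⟩
    have h0 : ∀ J : ℕ →₀ ℕ, J ≠ 0 → MvPowerSeries.coeff J (c • (1 : Formal p)) = 0 := by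
      intro J hJ
      rw [MvPowerSeries.coeff_smul, MvPowerSeries.coeff_one, if_neg hJ]; simp
    ext I
    rw [map_add, coeff_vir_neg_one_eq_zero _ I (fun J hJ _ => h0 J hJ), coeff_vir_zero, zero_add,
      map_zero]
    by_cases hI : I = 0
    · rw [(wt_eq_zero_iff I).2 hI]; simp
    · rw [h0 I hI, mul_zero]

/-- `L[-1]` on linear states. -/
theorem vir_neg_one_add_vir_zero_lin (a : ℕ → ℚ_[p]) :
    vir (-1) (lin a) + vir 0 (lin a) = lin (p := p) fun m => ((m : ℚ_[p]) + 1) * a m + m * a (m - 1) := by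
  rw [vir_lin a le_rfl, vir_lin a (by norm_num), lin_add]
  congr 1
  funext k
  have h : (-1 + (k : ℤ)).toNat = k - 1 := by omega
  simp only [Pi.add_apply, h]
  push_cast
  simp only [zero_add, Int.toNat_natCast]
  ring

/-- The partial sums of `L[0]` on linear states. -/
theorem sum_sqCoeff_zero_smul_vir_lin (a : ℕ → ℚ_[p]) (F : Finset ℤ) :
    ∑ m ∈ F, sqCoeff p 0 m • vir m (lin a) =
      lin (p := p) fun k => ∑ n ∈ F.preimage ((↑) : ℕ → ℤ) Nat.cast_injective.injOn,
        sqCoeff p 0 n * (((k : ℚ_[p]) + n + 1) * a (k + n)) := by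
  rw [← Finset.sum_preimage ((↑) : ℕ → ℤ) F Nat.cast_injective.injOn]
  · have h : ∀ n : ℕ, sqCoeff p 0 n • vir n (lin a) =
        lin (p := p) fun k => sqCoeff p 0 n * (((k : ℚ_[p]) + n + 1) * a (k + n)) := by
      intro n
      rw [vir_lin a (by omega), lin_smul]
      congr 1
      funext k
      have h : ((n : ℤ) + (k : ℤ)).toNat = k + n := by omega
      simp only [Pi.smul_apply, smul_eq_mul, h]
      push_cast
      ring
    simp only [h]
    rw [lin_sum]
    congr 1
    funext k
    simp
  · intro m _ hm
    have : m < 0 := by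
      by_contra h
      exact hm ⟨m.toNat, by omega⟩
    rw [sqCoeff_eq_zero p (by norm_num) this, zero_smul]

theorem isSqVir_zero_stirlingCoeff (R : ℝ) {N : ℕ} (hN : N ≠ 0) :
    IsSqVir R 0 (lin (stirlingCoeff p N)) ((N : ℚ_[p]) • lin (stirlingCoeff p N)) := by
  refine tendsto_const_nhds.congr' ?_
  filter_upwards [eventually_ge_atTop ((Finset.range N).image ((↑) : ℕ → ℤ))] with F hF
  have h : ∀ k : ℕ, ∑ n ∈ F.preimage ((↑) : ℕ → ℤ) Nat.cast_injective.injOn,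
        sqCoeff p 0 n * ((k + n + 1) * stirlingCoeff p N (k + n)) = N * stirlingCoeff p N k := by
    intro k
    rw [← sum_sqCoeff_mul_stirlingCoeff p hN k N le_rfl]
    symm
    refine Finset.sum_subset (fun n hn => ?_) (fun n _ hn => ?_)
    · rw [Finset.mem_preimage]
      exact hF (Finset.mem_image_of_mem _ hn)
    · rw [Finset.mem_range, not_lt] at hn
      rw [stirlingCoeff_eq_zero p (by omega), mul_zero, mul_zero]
  rw [sum_sqCoeff_zero_smul_vir_lin, if_neg (by norm_num), sub_zero, lin_smul]
  simp only [h]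
  rw [lin_sub]
  have : ((fun k => (N : ℚ_[p]) * stirlingCoeff p N k) - (N : ℚ_[p]) • stirlingCoeff p N) = 0 := by
    funext k; simp
  rw [this, show lin (0 : ℕ → ℚ_[p]) = 0 from (eq_lin (by simp) (by simp)).symm, normR_zero]

end SquareBracketModes

/-! ### Growth of `|m!|` and of the coefficients of `L[0]`. -/

section Estimates

variable (p : ℕ) [Fact p.Prime]

theorem norm_natCast_eq {n : ℕ} (hn : n ≠ 0) :
    ‖(n : ℚ_[p])‖ = ((p : ℝ) ^ padicValNat p n)⁻¹ := by
  rw [Padic.norm_eq_zpow_neg_valuation (by exact_mod_cast hn), Padic.valuation_natCast, zpow_neg,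
    zpow_natCast]

theorem inv_norm_natCast_le {n : ℕ} (hn : n ≠ 0) : ‖(n : ℚ_[p])‖⁻¹ ≤ n := by
  rw [norm_natCast_eq p hn, inv_inv]
  exact_mod_cast Nat.le_of_dvd (Nat.pos_of_ne_zero hn) pow_padicValNat_dvd

/-- A consequence of Legendre's formula. -/
theorem le_sub_one_mul_padicValNat_factorial {m : ℕ} (hm : m ≠ 0) :
    m ≤ (p - 1) * (padicValNat p m.factorial + (Nat.log p m + 1)) := by
  have hp : 1 < p := (Fact.out : p.Prime).one_lt
  have h1 := sub_one_mul_padicValNat_factorial (p := p) m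
  have h2 : (p.digits m).sum ≤ (Nat.log p m + 1) * (p - 1) := by
    rw [← Nat.length_digits p m hp hm]
    refine List.sum_le_card_nsmul _ _ fun d hd => ?_
    have := Nat.digits_lt_base hp hd
    omega
  rw [mul_add, h1]
  rw [mul_comm] at h2
  omega

/-- With `ρ = p^(1/(p-1))`, so `ρ^(p-1) = p`, Legendre's formula gives `|m!|` of size `ρ^(-m)` up to
the digit sum of `m`, whose effect is at most the factor `p * m`. Hence the upper bound on `r`. -/
theorem norm_factorial_mul_pow_le {r : ℝ} (hr : 0 ≤ r) {m : ℕ} (hm : m ≠ 0) :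
    ‖(m.factorial : ℚ_[p])‖ * r ^ m ≤
      p * (m * (r / (p : ℝ) ^ (1 / ((p : ℝ) - 1))) ^ m) := by
  have hp : 1 < p := (Fact.out : p.Prime).one_lt
  have hp' : (1 : ℝ) < p := by exact_mod_cast hp
  have hp0 : (0 : ℝ) < p := by linarith
  set ρ : ℝ := (p : ℝ) ^ (1 / ((p : ℝ) - 1)) with hρ
  have hρ1 : 1 ≤ ρ := Real.one_le_rpow hp'.le (by apply div_nonneg <;> linarith)
  have hρp : ρ ^ (p - 1) = p := by
    rw [hρ, ← Real.rpow_natCast, ← Real.rpow_mul hp0.le, Nat.cast_sub hp.le, Nat.cast_one,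
      one_div_mul_cancel (by linarith), Real.rpow_one]
  set v := padicValNat p m.factorial with hv
  have h1 : ρ ^ m ≤ (p : ℝ) ^ v * (p * m) := by
    calc ρ ^ m ≤ ρ ^ ((p - 1) * (v + (Nat.log p m + 1))) :=
          pow_le_pow_right₀ hρ1 (le_sub_one_mul_padicValNat_factorial p hm)
      _ = (p : ℝ) ^ v * (p * (p : ℝ) ^ Nat.log p m) := by
          rw [pow_mul, hρp]; ring
      _ ≤ (p : ℝ) ^ v * (p * m) := by
          gcongr
          exact_mod_cast Nat.pow_log_le_self p hm
  rw [norm_natCast_eq p (Nat.factorial_ne_zero m), ← hv]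
  have hpv : (0 : ℝ) < (p : ℝ) ^ v := by positivity
  have hρm : (0 : ℝ) < ρ ^ m := by positivity
  rw [div_pow, inv_mul_le_iff₀ hpv]
  calc r ^ m = ρ ^ m * (r ^ m / ρ ^ m) := by field_simp
    _ ≤ ((p : ℝ) ^ v * (p * m)) * (r ^ m / ρ ^ m) := by gcongr
    _ = _ := by ring

theorem tendsto_norm_factorial_mul_pow {r : ℝ} (hr : 0 ≤ r)
    (hr' : r < (p : ℝ) ^ (1 / ((p : ℝ) - 1))) :
    Tendsto (fun m : ℕ => ‖(m.factorial : ℚ_[p])‖ * r ^ (m + 1)) atTop (𝓝 0) := by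
  have hρ : 0 < (p : ℝ) ^ (1 / ((p : ℝ) - 1)) := hr.trans_lt hr'
  have h := ((tendsto_self_mul_const_pow_of_lt_one (div_nonneg hr hρ.le)
    ((div_lt_one hρ).2 hr')).const_mul (p : ℝ)).mul_const r
  rw [mul_zero, zero_mul] at h
  refine squeeze_zero' (Eventually.of_forall fun m => by positivity) ?_ h
  filter_upwards [eventually_ne_atTop 0] with m hm
  rw [pow_succ, ← mul_assoc]
  exact mul_le_mul_of_nonneg_right (norm_factorial_mul_pow_le p hr hm) hr

/-- The `p`-adic size of `1/(n(n+1))` is at most `n(n+1)`, which any geometric decay beats. -/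
theorem tendsto_norm_sqCoeff_zero_mul_inv_pow {r : ℝ} (hr : 1 < r) :
    Tendsto (fun n : ℕ => ‖sqCoeff p 0 n‖ * r⁻¹ ^ n) atTop (𝓝 0) := by
  have h1 : r⁻¹ < 1 := inv_lt_one_of_one_lt₀ hr
  have h0 : 0 ≤ r⁻¹ := by positivity
  have h := (tendsto_pow_const_mul_const_pow_of_lt_one 2 h0 h1).const_mul 2
  rw [mul_zero] at h
  refine squeeze_zero' (Eventually.of_forall fun m => by positivity) ?_ h
  filter_upwards [eventually_ge_atTop 1] with n hn
  rw [← mul_assoc]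
  gcongr
  rw [sqCoeff_zero_natCast p (by omega), norm_div, norm_pow, norm_neg, norm_one, one_pow, norm_mul,
    one_div, mul_inv]
  have h2 := inv_norm_natCast_le p (n := n) (by omega)
  have h3 := inv_norm_natCast_le p n.succ_ne_zero
  push_cast at h3
  have hn' : (1 : ℝ) ≤ n := by exact_mod_cast hn
  calc _ ≤ (n : ℝ) * (n + 1) := by gcongr
    _ ≤ _ := by nlinarith

end Estimates

/-! ### Limits of the eigenstates along integers converging in weight space. -/

section Limits

variable {p : ℕ} [Fact p.Prime]

theorem exists_seq_tendsto_weight (t : WeightSpace p) :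
    ∃ N : ℕ → ℕ, (∀ i, N i ≠ 0) ∧
      Tendsto (fun i => (((N i : ℕ) : ℤ) : WeightSpace p)) atTop (𝓝 t) := by
  have hp : p.Prime := Fact.out
  have hcop : ∀ i, (p ^ i).Coprime (p - 1) := fun i =>
    Nat.Coprime.pow_left i (Nat.coprime_self_sub_right hp.one_lt.le |>.2 (Nat.coprime_one_right p))
  have : NeZero (p - 1) := ⟨by have := hp.one_lt; omega⟩
  -- The Chinese remainder theorem matches `t` modulo `p^i` and modulo `p - 1`; adding `p^i (p-1)`
  -- keeps both residues and makes `N i` positive.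
  let N : ℕ → ℕ := fun i =>
    (Nat.chineseRemainder (hcop i) (t.1.appr i) t.2.val : ℕ) + p ^ i * (p - 1)
  have hN1 : ∀ i, N i ≡ t.1.appr i [MOD p ^ i] := fun i => by
    simpa [N, Nat.ModEq] using (Nat.chineseRemainder (hcop i) (t.1.appr i) t.2.val).2.1
  have hN2 : ∀ i, N i ≡ t.2.val [MOD (p - 1)] := fun i => by
    simpa [N, Nat.ModEq] using (Nat.chineseRemainder (hcop i) (t.1.appr i) t.2.val).2.2
  refine ⟨N, fun i => ?_, ?_⟩
  · have : 0 < p ^ i * (p - 1) :=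
      Nat.mul_pos (pow_pos hp.pos i) (by have := hp.one_lt; omega)
    simp only [N]
    omega
  · have hcast : ∀ i, (((N i : ℕ) : ℤ) : WeightSpace p) = ((N i : ℤ_[p]), t.2) := by
      intro i
      refine Prod.ext (by simp) ?_
      have := (ZMod.natCast_eq_natCast_iff _ _ _).2 (hN2 i)
      simpa using this
    simp only [hcast]
    refine Tendsto.prodMk_nhds ?_ tendsto_const_nhds
    rw [tendsto_iff_norm_sub_tendsto_zero]
    have hlim : Tendsto (fun i : ℕ => ((p : ℝ)⁻¹) ^ i) atTop (𝓝 0) :=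
      tendsto_pow_atTop_nhds_zero_of_lt_one (by positivity)
        (inv_lt_one_of_one_lt₀ (by exact_mod_cast hp.one_lt))
    refine squeeze_zero (fun _ => norm_nonneg _) (fun i => ?_) hlim
    rw [← norm_neg, neg_sub, inv_pow, ← zpow_natCast, ← zpow_neg,
      PadicInt.norm_le_pow_iff_mem_span_pow]
    have h1 := PadicInt.appr_spec i t.1
    have h2 : ((t.1.appr i : ℕ) : ℤ_[p]) - (N i : ℤ_[p]) ∈ Ideal.span {(p : ℤ_[p]) ^ i} := by
      rw [Ideal.mem_span_singleton]
      have h3 := (Nat.modEq_iff_dvd.1 (hN1 i))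
      have h4 := map_dvd (Int.castRingHom ℤ_[p]) h3
      simpa using h4
    have h5 := add_mem h1 h2
    simpa using h5

/-- By compactness, along integers converging to a given weight one can arrange that the
coefficients of the states `(N-1)! h[-N]𝟏` converge. -/
theorem exists_seq_tendsto_stirlingCoeff (t : WeightSpace p) :
    ∃ (N : ℕ → ℕ) (a : ℕ → ℚ_[p]), (∀ i, N i ≠ 0) ∧
      Tendsto (fun i => (((N i : ℕ) : ℤ) : WeightSpace p)) atTop (𝓝 t) ∧
      ∀ m, Tendsto (fun i => stirlingCoeff p (N i) m) atTop (𝓝 (a m)) := by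
  obtain ⟨N, hN, ht⟩ := exists_seq_tendsto_weight t
  obtain ⟨b, φ, hφ, hb⟩ := CompactSpace.tendsto_subseq
    (fun i m => ((m.factorial * (N i).stirlingSecond (m + 1) : ℕ) : ℤ_[p]))
  refine ⟨N ∘ φ, fun m => (b m : ℚ_[p]), fun i => hN _, ht.comp hφ.tendsto_atTop, fun m => ?_⟩
  have h := (continuous_subtype_val.tendsto (b m)).comp ((tendsto_pi_nhds.1 hb) m)
  refine h.congr fun i => ?_
  exact PadicInt.coe_natCast _

variable {N : ℕ → ℕ} {a : ℕ → ℚ_[p]}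

theorem norm_le_norm_factorial (ha : ∀ m, Tendsto (fun i => stirlingCoeff p (N i) m) atTop (𝓝 (a m)))
    (m : ℕ) : ‖a m‖ ≤ ‖(m.factorial : ℚ_[p])‖ :=
  le_of_tendsto (ha m).norm (Eventually.of_forall fun i => norm_stirlingCoeff_le p (N i) m)

theorem lin_limit_mem_SR {r : ℝ} (hr : 0 ≤ r) (hr' : r < (p : ℝ) ^ (1 / ((p : ℝ) - 1)))
    (ha : ∀ m, Tendsto (fun i => stirlingCoeff p (N i) m) atTop (𝓝 (a m))) : lin a ∈ SR p r :=
  lin_mem_SR (squeeze_zero (fun m => by positivity)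
    (fun m => mul_le_mul_of_nonneg_right (norm_le_norm_factorial ha m) (by positivity))
    (tendsto_norm_factorial_mul_pow p hr hr'))

theorem lin_limit_ne_zero (hN : ∀ i, N i ≠ 0)
    (ha : ∀ m, Tendsto (fun i => stirlingCoeff p (N i) m) atTop (𝓝 (a m))) : lin a ≠ 0 := by
  intro h
  have h0 : a 0 = 1 := by
    refine tendsto_nhds_unique (ha 0) ?_
    simp only [stirlingCoeff_zero p (hN _)]
    exact tendsto_const_nhds
  have h1 := congrArg (MvPowerSeries.coeff (Finsupp.single 0 1)) h
  rw [coeff_lin_single, h0, map_zero] at h1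
  exact one_ne_zero h1

/-- Dominated convergence: the bound `|m!| → 0` controls the tail uniformly in `i`, and finitely
many coefficients remain. -/
theorem tendsto_normR_sub
    (ha : ∀ m, Tendsto (fun i => stirlingCoeff p (N i) m) atTop (𝓝 (a m))) :
    Tendsto (fun i => normR 1 (lin (stirlingCoeff p (N i)) - lin a)) atTop (𝓝 0) := by
  have hp : 1 < (p : ℝ) := by exact_mod_cast (Fact.out : p.Prime).one_lt
  have hfac := tendsto_norm_factorial_mul_pow p zero_le_one
    (Real.one_lt_rpow hp (one_div_pos.2 (by linarith)))
  rw [ENNReal.tendsto_nhds_zero]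
  intro ε hε
  obtain ⟨δ, hδ, hδε⟩ : ∃ δ : ℝ, 0 < δ ∧ ENNReal.ofReal δ ≤ ε := by
    rcases eq_or_ne ε ⊤ with rfl | htop
    · exact ⟨1, one_pos, le_top⟩
    · exact ⟨ε.toReal, ENNReal.toReal_pos hε.ne' htop, (ENNReal.ofReal_toReal htop).le⟩
  obtain ⟨M, hM⟩ := eventually_atTop.1 (hfac.eventually (gt_mem_nhds hδ))
  have hhead : ∀ᶠ i in atTop, ∀ m ∈ Finset.range M, ‖stirlingCoeff p (N i) m - a m‖ < δ := by
    rw [Filter.eventually_all_finset]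
    intro m _
    have := tendsto_iff_norm_sub_tendsto_zero.1 (ha m)
    exact this.eventually (gt_mem_nhds hδ)
  filter_upwards [hhead] with i hi
  refine le_trans ?_ hδε
  rw [lin_sub]
  refine normR_lin_le fun k => ?_
  rw [one_pow, mul_one, Pi.sub_apply]
  rcases lt_or_ge k M with hk | hk
  · exact (hi k (Finset.mem_range.2 hk)).le
  · have h1 := hM k hk
    rw [one_pow, mul_one] at h1
    rw [sub_eq_add_neg]
    refine (IsUltrametricDist.norm_add_le_max _ _).trans (max_le ?_ ?_)
    · exact (norm_stirlingCoeff_le p (N i) k).trans h1.le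
    · rw [norm_neg]
      exact (norm_le_norm_factorial ha k).trans h1.le

theorem hasXWeight_lin_limit {t : WeightSpace p} (hN : ∀ i, N i ≠ 0)
    (ht : Tendsto (fun i => (((N i : ℕ) : ℤ) : WeightSpace p)) atTop (𝓝 t))
    (ha : ∀ m, Tendsto (fun i => stirlingCoeff p (N i) m) atTop (𝓝 (a m))) :
    HasXWeight (lin a) t := by
  have hv : ∀ i, ((∑ m ∈ Finset.range (N i), MvPolynomial.monomial (Finsupp.single m 1)
      (stirlingCoeff p (N i) m) : SAlg p) : Formal p) = lin (stirlingCoeff p (N i)) :=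
    fun i => lin_eq_coe_sum _ _ fun m hm => stirlingCoeff_eq_zero p hm
  refine ⟨fun i => ∑ m ∈ Finset.range (N i), MvPolynomial.monomial (Finsupp.single m 1)
    (stirlingCoeff p (N i) m), fun i => N i, fun i => ?_, ?_, ht⟩
  · rw [hv, Int.cast_natCast]
    exact isSqVir_zero_stirlingCoeff 1 (hN i)
  · simp only [hv]
    exact tendsto_normR_sub ha

/-- A limit of the states `(N-1)! h[-N]𝟏` is an eigenvector of `L[0]`. -/
theorem isSqVir_zero_lin_limit {r : ℝ} (hr : 1 < r) (hr' : r < (p : ℝ) ^ (1 / ((p : ℝ) - 1)))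
    {s : ℤ_[p]} (hN : ∀ i, N i ≠ 0)
    (hs : Tendsto (fun i => (N i : ℤ_[p])) atTop (𝓝 s))
    (ha : ∀ m, Tendsto (fun i => stirlingCoeff p (N i) m) atTop (𝓝 (a m))) :
    IsSqVir r 0 (lin a) ((s : ℚ_[p]) • lin a) := by
  have hr0 : 0 < r := by linarith
  obtain ⟨B, hB⟩ := (tendsto_norm_factorial_mul_pow p hr0.le hr').bddAbove_range
  have hB' : ∀ m : ℕ, ‖(m.factorial : ℚ_[p])‖ * r ^ (m + 1) ≤ B := fun m => hB ⟨m, rfl⟩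
  have hB0 : 0 ≤ B := le_trans (by positivity) (hB' 0)
  have hc := (tendsto_norm_sqCoeff_zero_mul_inv_pow p hr).mul_const B
  rw [zero_mul] at hc
  have hs' : Tendsto (fun i => (N i : ℚ_[p])) atTop (𝓝 (s : ℚ_[p])) := by
    refine ((continuous_subtype_val.tendsto s).comp hs).congr fun i => ?_
    exact PadicInt.coe_natCast _
  -- Uniform in `i` and `k`: the shift of degree by `n` supplies the factor `r⁻¹ ^ n` that tames
  -- `sqCoeff p 0 n`.
  have hterm : ∀ (i k n : ℕ),
      ‖sqCoeff p 0 n * (((k : ℚ_[p]) + n + 1) * stirlingCoeff p (N i) (k + n))‖ * r ^ (k + 1) ≤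
        ‖sqCoeff p 0 n‖ * r⁻¹ ^ n * B := by
    intro i k n
    have h1 : ‖(k : ℚ_[p]) + n + 1‖ ≤ 1 := by
      have := IsUltrametricDist.norm_natCast_le_one ℚ_[p] (k + n + 1)
      push_cast at this
      exact this
    have h2 := norm_stirlingCoeff_le p (N i) (k + n)
    have h3 : r ^ (k + 1) = r⁻¹ ^ n * r ^ (k + n + 1) := by
      rw [show k + n + 1 = n + (k + 1) by ring, pow_add r n, ← mul_assoc, ← mul_pow,
        inv_mul_cancel₀ hr0.ne', one_pow, one_mul]
    rw [norm_mul, norm_mul]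
    calc _ ≤ ‖sqCoeff p 0 n‖ * (1 * ‖((k + n).factorial : ℚ_[p])‖) * r ^ (k + 1) := by gcongr
      _ = ‖sqCoeff p 0 n‖ * r⁻¹ ^ n * (‖((k + n).factorial : ℚ_[p])‖ * r ^ (k + n + 1)) := by
        rw [h3]; ring
      _ ≤ _ := by gcongr; exact hB' _
  rw [IsSqVir, ENNReal.tendsto_nhds_zero]
  intro ε hε
  obtain ⟨δ, hδ, hδε⟩ : ∃ δ : ℝ, 0 < δ ∧ ENNReal.ofReal δ ≤ ε := by
    rcases eq_or_ne ε ⊤ with rfl | htop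
    · exact ⟨1, one_pos, le_top⟩
    · exact ⟨ε.toReal, ENNReal.toReal_pos hε.ne' htop, (ENNReal.ofReal_toReal htop).le⟩
  obtain ⟨M, hM⟩ := eventually_atTop.1 (hc.eventually (gt_mem_nhds hδ))
  filter_upwards [eventually_ge_atTop ((Finset.range M).image ((↑) : ℕ → ℤ))] with F hF
  refine le_trans ?_ hδε
  rw [sum_sqCoeff_zero_smul_vir_lin, if_neg (by norm_num), sub_zero, lin_smul, lin_sub]
  refine normR_lin_le fun k => ?_
  set G := F.preimage ((↑) : ℕ → ℤ) Nat.cast_injective.injOn with hG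
  have hGM : ∀ n, n ∉ G → M ≤ n := by
    intro n hn
    by_contra h
    refine hn ?_
    rw [hG, Finset.mem_preimage]
    exact hF (Finset.mem_image_of_mem _ (Finset.mem_range.2 (not_le.1 h)))
  -- For fixed `F` and `k` only finitely many coefficients occur, so it suffices to bound the error
  -- for each `N i` and let `i → ∞`.
  have hlim : Tendsto (fun i => ‖∑ n ∈ G, sqCoeff p 0 n *
      (((k : ℚ_[p]) + n + 1) * stirlingCoeff p (N i) (k + n)) -
        N i * stirlingCoeff p (N i) k‖ * r ^ (k + 1)) atTop
      (𝓝 (‖∑ n ∈ G, sqCoeff p 0 n * (((k : ℚ_[p]) + n + 1) * a (k + n)) -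
        s * a k‖ * r ^ (k + 1))) := by
    refine Tendsto.mul_const _ (Tendsto.norm (Tendsto.sub ?_ (hs'.mul (ha k))))
    exact tendsto_finsetSum _ fun n _ => ((ha (k + n)).const_mul _).const_mul _
  refine le_of_tendsto hlim (Eventually.of_forall fun i => ?_)
  obtain ⟨T, hT⟩ : ∃ T, G ⊆ Finset.range T := ⟨G.sup id + 1, fun n hn =>
    Finset.mem_range.2 (Nat.lt_succ_of_le (Finset.le_sup (f := id) hn))⟩
  have hT' : G ⊆ Finset.range (max T (N i)) :=
    hT.trans (Finset.range_mono (le_max_left _ _))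
  -- For `N i` the eigenvalue equation is an exact finite sum, so the error is minus the terms
  -- outside `G`. These all have `n ≥ M`, and the ultrametric inequality bounds their sum.
  rw [← sum_sqCoeff_mul_stirlingCoeff p (hN i) k (max T (N i)) (le_max_right _ _),
    ← Finset.sum_sdiff hT', sub_add_cancel_right, norm_neg, ← le_div_iff₀ (by positivity)]
  refine IsUltrametricDist.norm_sum_le_of_forall_le_of_nonneg (by positivity) fun n hn => ?_
  rw [le_div_iff₀ (by positivity)]
  exact (hterm i k n).trans (hM n (hGM n (Finset.mem_sdiff.1 hn).2)).le

end Limits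

end PadicHeisenberg

end

/-! ### The main theorem. -/

theorem theorem4p4 (p : ℕ) [Fact p.Prime] (r : ℝ)
    (hr₁ : (p : ℝ) ^ (1 / (p : ℝ)) ≤ r) (hr₂ : r < (p : ℝ) ^ (1 / ((p : ℝ) - 1))) :
    -- (a) every weight is the `X`-weight of a nonzero state in `S_r`
    (∀ t : PadicHeisenberg.WeightSpace p,
      ∃ u ∈ PadicHeisenberg.SR p r, u ≠ 0 ∧ PadicHeisenberg.HasXWeight u t) ∧
    -- (b) every `p`-adic integer is an eigenvalue of `L[0]` on `S_r`
    (∀ s : ℤ_[p],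
      ∃ u ∈ PadicHeisenberg.SR p r, u ≠ 0 ∧
        PadicHeisenberg.IsSqVir r 0 u ((s : ℚ_[p]) • u)) ∧
    -- every odd weight is the `X`-weight of a nonzero state `w = L[-1]u`
    (∀ t : PadicHeisenberg.WeightSpace p, ¬ Even t →
      ∃ u ∈ PadicHeisenberg.SR p r, ∃ w ∈ PadicHeisenberg.SR p r,
        PadicHeisenberg.HasXWeight u (t - 1) ∧ PadicHeisenberg.IsSqVir r (-1) u w ∧
        w ≠ 0 ∧ PadicHeisenberg.HasXWeight w t) ∧
    -- the kernel of `L[-1]` on `S = S_1` is the line spanned by the vacuum vector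
    (∀ u ∈ PadicHeisenberg.SR p 1,
      PadicHeisenberg.IsSqVir 1 (-1) u 0 ↔ ∃ c : ℚ_[p], u = c • (1 : PadicHeisenberg.Formal p)) := by
  have hp : 1 < (p : ℝ) := by exact_mod_cast (Fact.out : p.Prime).one_lt
  have hr : 1 < r := (Real.one_lt_rpow hp (one_div_pos.2 (by linarith))).trans_le hr₁
  have hr0 : 0 < r := by linarith
  refine ⟨fun t => ?_, fun s => ?_, fun t _ => ?_, fun u _ => ?_⟩
  · obtain ⟨N, a, hN, ht, ha⟩ := PadicHeisenberg.exists_seq_tendsto_stirlingCoeff t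
    exact ⟨_, PadicHeisenberg.lin_limit_mem_SR hr0.le hr₂ ha,
      PadicHeisenberg.lin_limit_ne_zero hN ha, PadicHeisenberg.hasXWeight_lin_limit hN ht ha⟩
  -- Any second component would do: the eigenvalue sees only the `ℤ_p`-part of the weight.
  · obtain ⟨N, a, hN, ht, ha⟩ := PadicHeisenberg.exists_seq_tendsto_stirlingCoeff (s, 0)
    refine ⟨_, PadicHeisenberg.lin_limit_mem_SR hr0.le hr₂ ha,
      PadicHeisenberg.lin_limit_ne_zero hN ha,
      PadicHeisenberg.isSqVir_zero_lin_limit hr hr₂ hN ?_ ha⟩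
    refine ((continuous_fst.tendsto _).comp ht).congr fun i => ?_
    simp
  · obtain ⟨N, a, hN, ht, ha⟩ := PadicHeisenberg.exists_seq_tendsto_stirlingCoeff (t - 1)
    -- By the Stirling recurrence the coefficients of `L[-1]u` are the limits along `N i + 1` of the
    -- same subsequence, so `L[-1]u` is again a limit state.
    have hb : ∀ m, Tendsto (fun i => PadicHeisenberg.stirlingCoeff p (N i + 1) m) atTop
        (𝓝 (((m : ℚ_[p]) + 1) * a m + m * a (m - 1))) := by
      intro m
      simp only [PadicHeisenberg.stirlingCoeff_succ p (hN _)]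
      exact ((ha m).const_mul _).add ((ha (m - 1)).const_mul _)
    have ht' : Tendsto (fun i => (((N i + 1 : ℕ) : ℤ) : PadicHeisenberg.WeightSpace p)) atTop
        (𝓝 t) := by
      have h := ht.add_const 1
      rw [sub_add_cancel] at h
      refine h.congr fun i => ?_
      push_cast
      rfl
    have hN' : ∀ i, N i + 1 ≠ 0 := fun i => Nat.succ_ne_zero _
    exact ⟨_, PadicHeisenberg.lin_limit_mem_SR hr0.le hr₂ ha, _,
      PadicHeisenberg.lin_limit_mem_SR hr0.le hr₂ hb,
      PadicHeisenberg.hasXWeight_lin_limit hN ht ha,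
      (PadicHeisenberg.isSqVir_neg_one_iff hr0 _ _).2
        (PadicHeisenberg.vir_neg_one_add_vir_zero_lin a),
      PadicHeisenberg.lin_limit_ne_zero hN' hb, PadicHeisenberg.hasXWeight_lin_limit hN' ht' hb⟩
  · exact PadicHeisenberg.isSqVir_neg_one_zero_iff one_pos u
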